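/- Let $E$ be the elliptic curve $y^2+xy=x^3+x^2-2x$ over $\mathbb{Q}$ and $P=(2,2)\in E(\mathbb{Q})$. Let $r$ be a non-negative integer, let $K_r\subset\mathbb{C}$ be the field generated over $\mathbb{Q}$ by the $x$- and $y$-coordinates of all points $\beta\in E(\mathbb{C})$ with $2^r\beta=P$, fix one such point $\beta_r$, and fix a basis $(A,B)$ of $E[2^r]\subset E(\mathbb{C})$ over $\mathbb{Z}/2^r\mathbb{Z}$. (All points of $E[2^r]$ have coordinates in $K_r$.) For $\sigma\in\mathrm{Gal}(K_r/\mathbb{Q})$ put $\rho_{E,2^r}(\sigma)=(\vec v,M)$, where $\vec v=\begin{bmatrix} e& f\end{bmatrix}$ is a row vector over $\mathbb{Z}/2^r\mathbb{Z}$ and $M=\begin{bmatrix} a&b\\ c&d\end{bmatrix}\in\mathrm{GL}_2(\mathbb{Z}/2^r\mathbb{Z})$ are determined by $$\sigma(\beta_r)=\beta_r+eA+fB,\qquad \sigma(A)=aA+bB,\qquad \sigma(B)=cA+dB .$$ Let $p\notin\{2,3,17\}$ be a prime, let $\mathfrak{p}$ be a prime ideal of $\mathcal{O}_{K_r}$ containing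 $p$, let $\sigma\in\mathrm{Gal}(K_r/\mathbb{Q})$ be a Frobenius element at $\mathfrak p$, i.e. $\sigma(\alpha)\equiv\alpha^p\pmod{\mathfrak p}$ for all $\alpha\in\mathcal{O}_{K_r}$, and let $(\vec v,M)=\rho_{E,2^r}(\sigma)$. Assume that $\det(I-M)\not\equiv 0\pmod{2^r}$. Write $\operatorname{im}(I-M)=\{\vec x(I-M):\vec x\in(\mathbb{Z}/2^r\mathbb{Z})^2\}$ for the image of $I-M$ acting on row vectors. Then for every integer $h\ge 0$, the point $2^hP$ has odd order in $E(\mathbb{F}_p)$ if and only if $2^h\vec v\in\operatorname{im}(I-M)$. Consequently the $2$-part of the order of $P$ in $E(\mathbb{F}_p)$ is determined by $(\vec v,M)$: it is $2^o$, where $o$ is the smallest non-negative integer with $2^o\vec v\in\operatorname{im}(I-M)$. -/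

import Mathlib

open scoped NumberField Matrix WeierstrassCurve.Affine

namespace SomosFive

open WeierstrassCurve.Affine

/-- The integral Weierstrass equation `y² + xy = x³ + x² - 2x`
(coefficients in the order `a₁, a₂, a₃, a₄, a₆`). Its discriminant is `612 = 2² * 3² * 17`. -/
noncomputable def E : WeierstrassCurve ℤ := ⟨1, 1, 0, -2, 0⟩

/-- The group `E(F)` for a field `F`; for `F = ZMod p` this is the group of (nonsingular) points of
the reduction of `E` modulo `p`. -/
abbrev Pts (F : Type*) [Field F] : Type _ := (E⁄F).Point

theorem nonsingular_two_two {F : Type*} [Field F] (h6 : (6 : F) ≠ 0) :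
    (E⁄F).Nonsingular 2 2 := by
  rw [nonsingular_iff, equation_iff]
  simp only [E, WeierstrassCurve.baseChange, WeierstrassCurve.map]
  norm_num
  exact Or.inr fun h => h6 (by linear_combination h)

/-- The point `P = (2, 2)` of `E(F)`, for a field `F` of characteristic different from `2, 3`. -/
noncomputable def P (F : Type*) [Field F] (h6 : (6 : F) ≠ 0) : Pts F :=
  .some 2 2 (nonsingular_two_two h6)

theorem six_ne_zero_zmod {p : ℕ} [hp : Fact p.Prime] (h2 : p ≠ 2) (h3 : p ≠ 3) :
    (6 : ZMod p) ≠ 0 := by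
  intro h
  have h' : ((2 * 3 : ℕ) : ZMod p) = 0 := by push_cast; linear_combination h
  rw [ZMod.natCast_eq_zero_iff, hp.out.dvd_mul] at h'
  rcases h' with h' | h'
  · exact h2 ((Nat.prime_dvd_prime_iff_eq hp.out Nat.prime_two).1 h')
  · exact h3 ((Nat.prime_dvd_prime_iff_eq hp.out Nat.prime_three).1 h')

/-- The point `P = (2, 2)` of `E(ℂ)`. -/
noncomputable def PC : Pts ℂ := P ℂ (by norm_num)

/-- The reduction `(2, 2)` of `P` in `E(𝔽_p)`, for a prime `p ≠ 2, 3`. -/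
noncomputable def Pmod (p : ℕ) [Fact p.Prime] (h2 : p ≠ 2) (h3 : p ≠ 3) : Pts (ZMod p) :=
  P (ZMod p) (six_ne_zero_zmod h2 h3)

/-- The field `K_r`: the subfield of `ℂ` generated over `ℚ` by the `x`- and `y`-coordinates of all
points `β ∈ E(ℂ)` with `2 ^ r • β = P`. -/
noncomputable def K (r : ℕ) : IntermediateField ℚ ℂ :=
  IntermediateField.adjoin ℚ {z : ℂ | ∃ (x y : ℂ) (hxy : (E⁄ℂ).Nonsingular x y),
    2 ^ r • (Point.some x y hxy : Pts ℂ) = PC ∧ (z = x ∨ z = y)}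

/-- The inclusion `E(K_r) → E(ℂ)`. -/
noncomputable def toC (r : ℕ) : Pts (K r) →+ Pts ℂ :=
  Point.map (W' := E) (S := ℚ) (K r).val

theorem toC_injective (r : ℕ) : Function.Injective (toC r) := Point.map_injective _

/-- The action of `σ ∈ Gal(K_r/ℚ)` on the coordinates of the points of `E(K_r)`. -/
noncomputable def galK (r : ℕ) (σ : Gal(K r/ℚ)) : Pts (K r) →+ Pts (K r) :=
  Point.map (W' := E) (S := ℚ) (σ : K r →ₐ[ℚ] K r)

/-- The action of `σ ∈ Gal(K_r/ℚ)` on those points of `E(ℂ)` that have coordinates in `K_r`. -/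
noncomputable def gal (r : ℕ) (σ : Gal(K r/ℚ)) : (toC r).range →+ (toC r).range :=
  ((AddMonoidHom.ofInjective (toC_injective r)).toAddMonoidHom.comp (galK r σ)).comp
    (AddMonoidHom.ofInjective (toC_injective r)).symm.toAddMonoidHom

theorem galK_one (r : ℕ) (T : Pts (K r)) : galK r 1 T = T := by
  cases T <;> rfl

theorem galK_mul (r : ℕ) (σ τ : Gal(K r/ℚ)) (T : Pts (K r)) :
    galK r (σ * τ) T = galK r σ (galK r τ T) := by
  cases T <;> rfl

theorem gal_one (r : ℕ) (T : (toC r).range) : gal r 1 T = T := by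
  simp [gal, galK_one]

theorem gal_mul (r : ℕ) (σ τ : Gal(K r/ℚ)) (T : (toC r).range) :
    gal r (σ * τ) T = gal r σ (gal r τ T) := by
  simp [gal, galK_mul]

theorem toC_P (r : ℕ) (h6 : (6 : K r) ≠ 0) : toC r (P (K r) h6) = PC := by
  simp only [toC, P, PC, Point.map_some, Point.some.injEq]
  exact ⟨map_ofNat (K r).val 2, map_ofNat (K r).val 2⟩

theorem galK_P (r : ℕ) (σ : Gal(K r/ℚ)) (h6 : (6 : K r) ≠ 0) :
    galK r σ (P (K r) h6) = P (K r) h6 := by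
  simp only [galK, P, Point.map_some, Point.some.injEq]
  exact ⟨map_ofNat σ 2, map_ofNat σ 2⟩

/-- A point with `2 ^ r • β = P` has coordinates in `K_r`. -/
theorem mem_range_of_preimage {r : ℕ} {β : Pts ℂ} (hβ : 2 ^ r • β = PC) :
    β ∈ (toC r).range := by
  rcases β with _ | ⟨x, y, hxy⟩
  · exact ⟨0, rfl⟩
  · have hx : x ∈ K r := IntermediateField.subset_adjoin _ _ ⟨x, y, hxy, hβ, Or.inl rfl⟩
    have hy : y ∈ K r := IntermediateField.subset_adjoin _ _ ⟨x, y, hxy, hβ, Or.inr rfl⟩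
    have h : (E⁄(K r)).Nonsingular ⟨x, hx⟩ ⟨y, hy⟩ :=
      (E.toAffine.baseChange_nonsingular (f := (K r).val) (K r).val.injective _ _).1 hxy
    exact ⟨.some _ _ h, rfl⟩

/-- The group `E[2 ^ r]` of points of `E(ℂ)` killed by `2 ^ r`. -/
noncomputable abbrev Tors (r : ℕ) : AddSubgroup (Pts ℂ) := AddSubgroup.torsionBy (Pts ℂ) ((2 ^ r : ℕ) : ℤ)

noncomputable instance (r : ℕ) : Module (ZMod (2 ^ r)) (Tors r) := AddSubgroup.torsionBy.zmodModule

theorem mem_Tors {r : ℕ} {T : Pts ℂ} : T ∈ Tors r ↔ 2 ^ r • T = 0 :=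
  AddSubgroup.torsionBy.nsmul_iff

/-- The choices on which the representation depends: a point `β` with `2 ^ r • β = P`, and a basis
`(A, B)` of `E[2 ^ r]` over `ℤ/2 ^ r`. -/
structure Frame (r : ℕ) where
  β : Pts ℂ
  hβ : 2 ^ r • β = PC
  basis : Module.Basis (Fin 2) (ZMod (2 ^ r)) (Tors r)

namespace Frame

theorem tors_mem_range {r : ℕ} (φ : Frame r) (T : Tors r) : (T : Pts ℂ) ∈ (toC r).range := by
  have h1 := mem_range_of_preimage φ.hβ
  have h2 : φ.β + (T : Pts ℂ) ∈ (toC r).range :=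
    mem_range_of_preimage (by rw [nsmul_add, φ.hβ, mem_Tors.1 T.2, add_zero])
  simpa using sub_mem h2 h1

/-- The inclusion of `E[2 ^ r]` into the points with coordinates in `K_r`. -/
noncomputable def torsToRange {r : ℕ} (φ : Frame r) : Tors r →+ (toC r).range where
  toFun T := ⟨T, φ.tors_mem_range T⟩
  map_zero' := rfl
  map_add' _ _ := rfl

/-- The action of `σ` on `E[2 ^ r]`. -/
noncomputable def torsAct {r : ℕ} (φ : Frame r) (σ : Gal(K r/ℚ)) : Tors r →+ Tors r where
  toFun T := ⟨gal r σ (φ.torsToRange T), mem_Tors.2 (by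
    have h : 2 ^ r • φ.torsToRange T = 0 := Subtype.ext (mem_Tors.1 T.2)
    rw [← AddSubgroup.coe_nsmul, ← map_nsmul, h, map_zero, AddSubgroup.coe_zero])⟩
  map_zero' := Subtype.ext (by simp)
  map_add' _ _ := Subtype.ext (by simp)

theorem torsAct_one {r : ℕ} (φ : Frame r) (T : Tors r) : φ.torsAct 1 T = T :=
  Subtype.ext (by simp [torsAct, gal_one, torsToRange])

theorem torsAct_mul {r : ℕ} (φ : Frame r) (σ τ : Gal(K r/ℚ)) (T : Tors r) :
    φ.torsAct (σ * τ) T = φ.torsAct σ (φ.torsAct τ T) :=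
  Subtype.ext (by simp [torsAct, gal_mul, torsToRange])

/-- The point `β`, which has coordinates in `K_r`. -/
noncomputable def betaK {r : ℕ} (φ : Frame r) : (toC r).range := ⟨φ.β, mem_range_of_preimage φ.hβ⟩

theorem nsmul_gal_betaK {r : ℕ} (φ : Frame r) (σ : Gal(K r/ℚ)) :
    2 ^ r • (gal r σ φ.betaK : Pts ℂ) = PC := by
  have h6 : (6 : K r) ≠ 0 := by norm_num
  have h : 2 ^ r • φ.betaK = AddMonoidHom.ofInjective (toC_injective r) (P (K r) h6) :=
    Subtype.ext (by
      rw [AddMonoidHom.ofInjective_apply, toC_P]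
      exact φ.hβ)
  rw [← AddSubgroup.coe_nsmul, ← map_nsmul, h]
  simp only [gal, AddMonoidHom.comp_apply, AddEquiv.coe_toAddMonoidHom, AddEquiv.symm_apply_apply,
    galK_P]
  exact toC_P r h6

/-- The point `σ(β) - β` of `E[2 ^ r]`. -/
noncomputable def shift {r : ℕ} (φ : Frame r) (σ : Gal(K r/ℚ)) : Tors r :=
  ⟨gal r σ φ.betaK - φ.β, mem_Tors.2 (by rw [nsmul_sub, φ.nsmul_gal_betaK, φ.hβ, sub_self])⟩

/-- The row vector `v = (e, f)` with `σ(β) = β + e A + f B`. -/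
noncomputable def vec {r : ℕ} (φ : Frame r) (σ : Gal(K r/ℚ)) : Fin 2 → ZMod (2 ^ r) :=
  fun j => φ.basis.repr (φ.shift σ) j

/-- The matrix `M` whose rows `(a, b)` and `(c, d)` are given by
`σ(A) = a A + b B` and `σ(B) = c A + d B`. -/
noncomputable def mat {r : ℕ} (φ : Frame r) (σ : Gal(K r/ℚ)) : Matrix (Fin 2) (Fin 2) (ZMod (2 ^ r)) :=
  Matrix.of fun i j => φ.basis.repr (φ.torsAct σ (φ.basis i)) j

theorem mat_eq {r : ℕ} (φ : Frame r) (σ : Gal(K r/ℚ)) :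
    φ.mat σ = (LinearMap.toMatrix φ.basis φ.basis
      ((φ.torsAct σ).toZModLinearMap (2 ^ r)))ᵀ := by
  ext i j
  simp [mat, LinearMap.toMatrix_apply]

theorem mat_one {r : ℕ} (φ : Frame r) : φ.mat 1 = 1 := by
  ext i j
  simp [mat, torsAct_one, Matrix.one_apply, Finsupp.single_apply]

theorem mat_mul {r : ℕ} (φ : Frame r) (σ τ : Gal(K r/ℚ)) :
    φ.mat (σ * τ) = φ.mat τ * φ.mat σ := by
  rw [mat_eq, mat_eq, mat_eq, ← Matrix.transpose_mul, ← LinearMap.toMatrix_comp]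
  congr 2
  ext T
  simp [torsAct_mul]

/-- The matrix `M` of `σ` as an element of `GL₂(ℤ/2 ^ r)`. -/
noncomputable def matGL {r : ℕ} (φ : Frame r) (σ : Gal(K r/ℚ)) : GL (Fin 2) (ZMod (2 ^ r)) where
  val := φ.mat σ
  inv := φ.mat σ⁻¹
  val_inv := by rw [← mat_mul, inv_mul_cancel, mat_one]
  inv_val := by rw [← mat_mul, mul_inv_cancel, mat_one]

/-- The map `ρ : Gal(K_r/ℚ) → AGL₂(ℤ/2 ^ r)`, `σ ↦ (v, M)`, where an element of
`AGL₂(ℤ/2 ^ r) = (ℤ/2 ^ r)² ⋊ GL₂(ℤ/2 ^ r)` is given as a pair of a row vector and a matrix. -/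
noncomputable def rho {r : ℕ} (φ : Frame r) (σ : Gal(K r/ℚ)) :
    (Fin 2 → ZMod (2 ^ r)) × GL (Fin 2) (ZMod (2 ^ r)) :=
  (φ.vec σ, φ.matGL σ)

end Frame

/-- The image of the matrix `N` acting on row vectors, `x ↦ x N`. -/
noncomputable def rowImage {n : ℕ} (N : Matrix (Fin 2) (Fin 2) (ZMod n)) : Submodule (ZMod n) (Fin 2 → ZMod n) :=
  LinearMap.range N.vecMulLinear

end SomosFive

/-!
The proof compares `E(K_r)` with the points of `E` over the residue field `k` of `𝔭`, through the
reduction homomorphism. Reduction turns the Frobenius element `σ` into the Frobenius endomorphism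
`F` of `E(k)` (`red_map_eq_map_frobenius_red`), is injective on `E[2 ^ r]` because `p` is odd
(`eq_zero_of_redHom_eq_zero`), and maps `E[2 ^ r]` onto the `2 ^ r`-torsion of `E(k)`, since a group
of points over a field of characteristic other than `2` has at most `4 ^ r` elements killed by
`2 ^ r` (`card_two_pow_torsion_le`, `Frame.exists_two_pow_nsmul_eq_zero_of_map`).

In coordinates, `2 ^ h v ∈ im (1 - M)` says that `2 ^ h β + T` is fixed by `σ` for some
`T ∈ E[2 ^ r]` (`Frame.smul_vec_mem_rowImage_iff`). If this holds, the reduction `Q` of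
`2 ^ h β + T` is fixed by `F` and `2 ^ r Q = 2 ^ h P`. As `det (1 - M) ≠ 0`, no point of order
`2 ^ r` is fixed by `σ`, so the `F`-fixed points of `2`-power order are killed by `2 ^ r`, and
`2 ^ r Q` has odd order. Conversely, if `2 ^ h P` has odd order modulo `p`, it equals `2 ^ r Q`
with `Q` one of its own multiples, hence fixed by `F`. The difference of `Q` and the reduction of
`2 ^ h β` is a `2 ^ r`-torsion point, the reduction of some `T`, and injectivity on torsion shows
that `σ` fixes `2 ^ h β + T`. This argument is `odd_addOrderOf_iff_of_equivariant`; it needs neither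
the Weil pairing nor a count of `E(𝔽_p)`.

That reduction is a homomorphism is shown by hand, for a valuation ring `A` with fraction field
`K`. Three affine points with sum zero lie on a line `y = ℓ x + μ`. If none of them is integral,
all reduce to infinity. Otherwise, if `ℓ` is integral, the line reduces to a line through the
reduced points, and if not, exactly one of the points reduces to infinity and the other two have
opposite reductions (`red_add_add`).
The field `K_r` is a number field because halving a point preserves algebraicity of its coordinates
(`Frame.finiteDimensional`), so that the local ring of `𝔭` is a valuation ring on which `σ` acts
(`frobenius_place`).
-/

namespace SomosFive

open WeierstrassCurve WeierstrassCurve.Affine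

/-! ### Lines and triples of points with sum zero -/

section Line

variable {F : Type*} [Field F] {W : Affine F}

/-- The line `y = ℓ x + μ` meets the curve `W` in the three points with `x`-coordinates
`x₁, x₂, x₃`, counted with multiplicity. The fields say that the cubic polynomial obtained by
substituting the line into the equation of `W` is `-(X - x₁)(X - x₂)(X - x₃)`. They are the three
coefficient identities, so that they can be transported along the reduction map. -/
structure LineSection (W : Affine F) (ℓ μ x₁ x₂ x₃ : F) : Prop where
  sum_eq : x₁ + x₂ + x₃ = ℓ ^ 2 + W.a₁ * ℓ - W.a₂
  sum_mul_eq : x₁ * x₂ + x₁ * x₃ + x₂ * x₃ = W.a₄ - W.a₁ * μ - 2 * ℓ * μ - W.a₃ * ℓ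
  mul_eq : x₁ * x₂ * x₃ = μ ^ 2 + W.a₃ * μ - W.a₆

theorem LineSection.swap₁₂ {ℓ μ x₁ x₂ x₃ : F} (h : LineSection W ℓ μ x₁ x₂ x₃) :
    LineSection W ℓ μ x₂ x₁ x₃ :=
  ⟨by linear_combination h.sum_eq, by linear_combination h.sum_mul_eq,
    by linear_combination h.mul_eq⟩

theorem LineSection.swap₂₃ {ℓ μ x₁ x₂ x₃ : F} (h : LineSection W ℓ μ x₁ x₂ x₃) :
    LineSection W ℓ μ x₁ x₃ x₂ :=
  ⟨by linear_combination h.sum_eq, by linear_combination h.sum_mul_eq,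
    by linear_combination h.mul_eq⟩

/-- The cubic equation, monic over the ring generated by `ℓ`, `μ` and the coefficients of the
curve, that makes `x₁` integral. -/
theorem LineSection.cubic_eq {ℓ μ x₁ x₂ x₃ : F} (h : LineSection W ℓ μ x₁ x₂ x₃) :
    x₁ ^ 3 = (ℓ ^ 2 + W.a₁ * ℓ - W.a₂) * x₁ ^ 2
      - (W.a₄ - W.a₁ * μ - 2 * ℓ * μ - W.a₃ * ℓ) * x₁ + (μ ^ 2 + W.a₃ * μ - W.a₆) := by
  rw [← h.sum_eq, ← h.sum_mul_eq, ← h.mul_eq]; ring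

/-- The slope times `y₁ - y(-P₂)`, free of denominators. It covers the tangent and the secant, and
reduces well when `x₁` and `x₂` become equal. -/
theorem LineSection.slope_mul_eq {ℓ μ x₁ x₂ x₃ : F} (h : LineSection W ℓ μ x₁ x₂ x₃) :
    ℓ * ((ℓ * x₁ + μ) - W.negY x₂ (ℓ * x₂ + μ)) =
      x₁ ^ 2 + x₁ * x₂ + x₂ ^ 2 + W.a₂ * (x₁ + x₂) + W.a₄ - W.a₁ * (ℓ * x₁ + μ) := by
  rw [negY]
  linear_combination h.sum_mul_eq - (x₁ + x₂) * h.sum_eq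

variable [DecidableEq F]

theorem add_add_eq_zero_of_lineSection {ℓ μ x₁ x₂ x₃ y₁ y₂ y₃ : F}
    (h : LineSection W ℓ μ x₁ x₂ x₃) (h₁ : W.Nonsingular x₁ y₁) (h₂ : W.Nonsingular x₂ y₂)
    (h₃ : W.Nonsingular x₃ y₃) (e₁ : y₁ = ℓ * x₁ + μ) (e₂ : y₂ = ℓ * x₂ + μ)
    (e₃ : y₃ = ℓ * x₃ + μ) :
    Point.some x₁ y₁ h₁ + Point.some x₂ y₂ h₂ + Point.some x₃ y₃ h₃ = 0 := by
  have key := h.slope_mul_eq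
  rw [← e₁, ← e₂] at key
  have hxy : ¬(x₁ = x₂ ∧ y₁ = W.negY x₂ y₂) := by
    rintro ⟨hx, hy⟩
    subst hx
    have hyy : y₂ = y₁ := by rw [e₁, e₂]
    subst hyy
    rw [sub_eq_zero.2 hy, mul_zero] at key
    -- The tangent at a point that is its own negative would have both partial derivatives zero.
    rcases ((nonsingular_iff ..).1 h₁).2 with hn | hn
    · exact hn (by linear_combination key)
    · exact hn hy
  have hsl : W.slope x₁ x₂ y₁ y₂ = ℓ := by
    by_cases hx : x₁ = x₂
    · subst hx
      have hyy : y₂ = y₁ := by rw [e₁, e₂]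
      subst hyy
      have hy : y₂ ≠ W.negY x₁ y₂ := fun h => hxy ⟨rfl, h⟩
      rw [slope_of_Y_ne rfl hy, div_eq_iff (sub_ne_zero.2 hy), key]
      ring
    · rw [slope_of_X_ne hx, div_eq_iff (sub_ne_zero.2 hx), e₁, e₂]
      ring
  have hx₃ : W.addX x₁ x₂ ℓ = x₃ := by
    rw [addX]; linear_combination -h.sum_eq
  rw [add_eq_zero_iff_eq_neg, Point.add_some hxy, Point.neg_some, Point.some.injEq, hsl, hx₃]
  refine ⟨rfl, ?_⟩
  rw [addY, negAddY, hx₃, e₁, e₃]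
  congr 1
  ring

theorem exists_lineSection {x₁ x₂ x₃ y₁ y₂ y₃ : F} (h₁ : W.Nonsingular x₁ y₁)
    (h₂ : W.Nonsingular x₂ y₂) (h₃ : W.Nonsingular x₃ y₃)
    (h : Point.some x₁ y₁ h₁ + Point.some x₂ y₂ h₂ + Point.some x₃ y₃ h₃ = 0) :
    ∃ ℓ μ, LineSection W ℓ μ x₁ x₂ x₃ ∧ y₁ = ℓ * x₁ + μ ∧ y₂ = ℓ * x₂ + μ ∧ y₃ = ℓ * x₃ + μ := by
  have hxy : ¬(x₁ = x₂ ∧ y₁ = W.negY x₂ y₂) := by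
    rintro ⟨hx, hy⟩
    rw [Point.add_of_Y_eq hx hy, zero_add] at h
    exact Point.some_ne_zero h₃ h
  rw [add_eq_zero_iff_eq_neg, Point.add_some hxy, Point.neg_some, Point.some.injEq] at h
  obtain ⟨hX, hY⟩ := h
  set ℓ := W.slope x₁ x₂ y₁ y₂ with hℓ
  have hp := addPolynomial_slope h₁.1 h₂.1 hxy
  rw [← hℓ, hX, addPolynomial_eq, neg_inj, Cubic.prod_X_sub_C_eq, Cubic.toPoly_injective] at hp
  have hb := congr_arg Cubic.b hp
  have hc := congr_arg Cubic.c hp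
  have hd := congr_arg Cubic.d hp
  simp only at hb hc hd
  have hy₂ : y₂ = ℓ * x₂ + (y₁ - ℓ * x₁) := by
    by_cases hx : x₁ = x₂
    · have := Y_eq_of_Y_ne h₁.1 h₂.1 hx fun h => hxy ⟨hx, h⟩
      rw [hx, this]; ring
    · rw [hℓ, slope_of_X_ne hx]
      field_simp [sub_ne_zero.2 hx]
      ring
  have hy₃ : y₃ = ℓ * x₃ + (y₁ - ℓ * x₁) := by
    rw [addY, negAddY, hX, negY, negY] at hY
    linear_combination hY
  refine ⟨ℓ, y₁ - ℓ * x₁, ⟨?_, ?_, ?_⟩, by ring, hy₂, hy₃⟩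
  · linear_combination hb
  · linear_combination -hc
  · linear_combination hd

end Line

/-! ### Coefficients of base changes -/

section BaseChange

variable (W : WeierstrassCurve ℤ) (F : Type*) [Field F]

theorem baseChange_a₁ : (W⁄F).a₁ = W.a₁ := rfl
theorem baseChange_a₂ : (W⁄F).a₂ = W.a₂ := rfl
theorem baseChange_a₃ : (W⁄F).a₃ = W.a₃ := rfl
theorem baseChange_a₄ : (W⁄F).a₄ = W.a₄ := rfl
theorem baseChange_a₆ : (W⁄F).a₆ = W.a₆ := rfl
theorem baseChange_Δ : (W⁄F).Δ = W.Δ := WeierstrassCurve.map_Δ _ _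

end BaseChange

/-! ### Reduction at a place -/

section Reduction

variable {K k : Type*} [Field K] [Field k] {A : ValuationSubring K} (ρ : A →+* k)

open Classical in
/-- The extension by zero of a homomorphism on a valuation ring `A` to its field of fractions. The
value `0` outside `A` is a junk value. -/
noncomputable def res (x : K) : k := if h : x ∈ A then ρ ⟨x, h⟩ else 0

@[simp]
theorem res_coe (a : A) : res ρ (a : K) = ρ a := by simp [res]

/-- `map_ofNat` does not fire in `simp` for numerals of `A`, whence this and the next lemma. -/
@[simp, norm_cast]
theorem coe_ofNat (n : ℕ) [n.AtLeastTwo] : ((ofNat(n) : A) : K) = ofNat(n) :=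
  map_ofNat A.subtype n

@[simp]
theorem map_ofNat_valuationSubring (n : ℕ) [n.AtLeastTwo] : ρ ofNat(n) = ofNat(n) :=
  map_ofNat ρ n

variable [IsLocalHom ρ]

/-- A local homomorphism on `A` kills every `u ∈ A` that multiplies a non-integral element into
`A`. -/
theorem map_eq_zero_of_mul_eq {x : K} (hx : x ∉ A) {u w : A} (h : x * u = w) : ρ u = 0 := by
  by_contra hu
  obtain ⟨v, hv⟩ := (isUnit_of_map_unit ρ u (isUnit_iff_ne_zero.2 hu)).exists_right_inv
  refine hx ?_
  have : x = ((w * v : A) : K) := by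
    have hv' : (u : K) * v = 1 := by exact_mod_cast congr_arg (Subtype.val) hv
    push_cast
    rw [← h, mul_assoc, hv', mul_one]
  rw [this]
  exact (w * v).2

theorem exists_mul_eq_one {x : K} (hx : x ∉ A) : ∃ b : A, x * b = 1 ∧ ρ b = 0 := by
  have hx0 : x ≠ 0 := fun h => hx (h ▸ A.zero_mem)
  have hb : x * ((⟨x⁻¹, (A.mem_or_inv_mem x).resolve_left hx⟩ : A) : K) = 1 := mul_inv_cancel₀ hx0
  exact ⟨_, hb, map_eq_zero_of_mul_eq ρ hx (w := 1) hb⟩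

include ρ in
/-- Valuation rings are integrally closed; stated for the cubic equations that occur here. -/
theorem mem_of_cubic {x : K} {c₂ c₁ c₀ : A} (h : x ^ 3 = c₂ * x ^ 2 + c₁ * x + c₀) : x ∈ A := by
  by_contra hx
  obtain ⟨b, hb, hb0⟩ := exists_mul_eq_one ρ hx
  have : (1 : A) = c₂ * b + c₁ * b ^ 2 + c₀ * b ^ 3 := Subtype.ext (by
    push_cast
    linear_combination (b : K) ^ 3 * h
      - (x ^ 2 * b ^ 2 + x * b + 1 - c₂ * b * (x * b + 1) - c₁ * b ^ 2) * hb)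
  simpa [hb0] using congr_arg ρ this

include ρ in
theorem mem_of_quadratic {x : K} {c₁ c₀ : A} (h : x ^ 2 = c₁ * x + c₀) : x ∈ A :=
  mem_of_cubic ρ (c₂ := c₁) (c₁ := c₀) (c₀ := 0) (by push_cast; linear_combination x * h)

variable (W : WeierstrassCurve ℤ)

include ρ in
theorem y_mem_of_equation {x y : K} (h : (W⁄K).Equation x y) (hx : x ∈ A) : y ∈ A := by
  lift x to A using hx
  refine mem_of_quadratic ρ (c₁ := -(W.a₁ * x + W.a₃))
    (c₀ := x ^ 3 + W.a₂ * x ^ 2 + W.a₄ * x + W.a₆) ?_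
  rw [equation_iff] at h
  simp only [baseChange_a₁, baseChange_a₂, baseChange_a₃, baseChange_a₄, baseChange_a₆] at h
  push_cast
  linear_combination h

omit [IsLocalHom ρ] in
theorem equation_map {x y : A} (h : (W⁄K).Equation (x : K) (y : K)) :
    (W⁄k).Equation (ρ x) (ρ y) := by
  rw [equation_iff] at h ⊢
  simp only [baseChange_a₁, baseChange_a₂, baseChange_a₃, baseChange_a₄, baseChange_a₆] at h ⊢
  have h' : y ^ 2 + W.a₁ * x * y + W.a₃ * y = x ^ 3 + W.a₂ * x ^ 2 + W.a₄ * x + W.a₆ :=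
    Subtype.ext (by push_cast; exact h)
  simpa using congr_arg ρ h'

variable {W}

theorem nonsingular_res (hΔ : (W.Δ : k) ≠ 0) {x y : K} (h : (W⁄K).Equation x y) (hx : x ∈ A) :
    (W⁄k).Nonsingular (res ρ x) (res ρ y) := by
  have hy := y_mem_of_equation ρ W h hx
  lift x to A using hx
  lift y to A using hy
  rw [res_coe, res_coe, ← equation_iff_nonsingular_of_Δ_ne_zero]
  · exact equation_map ρ W h
  · rwa [baseChange_Δ]

open Classical in
/-- Reduction of points. An affine point with non-integral `x`-coordinate reduces to the point at
infinity, and an affine point with integral `x`-coordinate also has integral `y`-coordinate and is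
reduced coordinatewise. The reduced curve is nonsingular because `W.Δ` is nonzero in `k`. -/
noncomputable def red (hΔ : (W.Δ : k) ≠ 0) : (W⁄K).Point → (W⁄k).Point
  | .zero => .zero
  | .some x _ h => if hx : x ∈ A then .some _ _ (nonsingular_res ρ hΔ h.1 hx) else .zero

variable (hΔ : (W.Δ : k) ≠ 0)

@[simp] theorem red_zero : red ρ hΔ (0 : (W⁄K).Point) = 0 := rfl

theorem red_some_of_mem {x y : K} (h : (W⁄K).Nonsingular x y) (hx : x ∈ A) :
    red ρ hΔ (.some x y h) = .some _ _ (nonsingular_res ρ hΔ h.1 hx) := dif_pos hx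

theorem red_some_of_notMem {x y : K} (h : (W⁄K).Nonsingular x y) (hx : x ∉ A) :
    red ρ hΔ (.some x y h) = 0 := dif_neg hx

theorem red_neg (T : (W⁄K).Point) : red ρ hΔ (-T) = -red ρ hΔ T := by
  rcases T with _ | ⟨x, y, h⟩
  · rfl
  · by_cases hx : x ∈ A
    · have hy := y_mem_of_equation ρ W h.1 hx
      rw [Point.neg_some, red_some_of_mem ρ hΔ _ hx, red_some_of_mem ρ hΔ h hx, Point.neg_some,
        Point.some.injEq]
      refine ⟨rfl, ?_⟩
      lift x to A using hx
      lift y to A using hy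
      have : (W⁄K).negY (x : K) (y : K) = ((-y - W.a₁ * x - W.a₃ : A) : K) := by
        simp [negY]
      rw [this, res_coe, res_coe, res_coe]
      simp [negY]
    · rw [Point.neg_some, red_some_of_notMem ρ hΔ _ hx, red_some_of_notMem ρ hΔ h hx]
      rfl

include ρ in
/-- A line of non-integral slope through an integral point does not meet the curve in two
non-integral points. With `u = ℓ⁻¹`, which reduces to `0`, both `u² (x₂ + x₃)` and `u² x₂ x₃` are
integral and the former reduces to `1`; but
`u² (x₂ + x₃) = u² x₂ x₃ (x₂⁻¹ + x₃⁻¹)` reduces to `0`. -/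
theorem mem_or_mem_of_lineSection {ℓ x₂ x₃ : K} {x₁ y₁ : A}
    (h : LineSection (W⁄K) ℓ (y₁ - ℓ * x₁) x₁ x₂ x₃) (hℓ : ℓ ∉ A) : x₂ ∈ A ∨ x₃ ∈ A := by
  by_contra! hx
  obtain ⟨u, hu, hu0⟩ := exists_mul_eq_one ρ hℓ
  obtain ⟨b₂, hb₂, hb₂0⟩ := exists_mul_eq_one ρ hx.1
  obtain ⟨b₃, hb₃, hb₃0⟩ := exists_mul_eq_one ρ hx.2
  have e₁ := h.sum_eq
  have e₂ := h.sum_mul_eq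
  simp only [baseChange_a₁, baseChange_a₂, baseChange_a₃, baseChange_a₄] at e₁ e₂
  -- `S = u² (x₂ + x₃)` and `T = u² x₂ x₃`
  obtain ⟨S, hS⟩ : ∃ S : A, S = 1 + W.a₁ * u - (W.a₂ + x₁) * u ^ 2 := ⟨_, rfl⟩
  obtain ⟨T, hT⟩ : ∃ T : A, T = (W.a₄ - W.a₁ * y₁) * u ^ 2 + W.a₁ * x₁ * u - 2 * y₁ * u + 2 * x₁
      - W.a₃ * u - x₁ * S := ⟨_, rfl⟩
  have hS' : (S : K) = u ^ 2 * (x₂ + x₃) := by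
    rw [hS]
    push_cast
    linear_combination -(u : K) ^ 2 * e₁ - (ℓ * u + 1 + W.a₁ * u) * hu
  have hT' : (T : K) = u ^ 2 * (x₂ * x₃) := by
    rw [hT]
    push_cast
    rw [hS']
    linear_combination -(u : K) ^ 2 * e₂
      - (W.a₁ * x₁ * u - 2 * y₁ * u - W.a₃ * u + 2 * x₁ * (ℓ * u + 1)) * hu
  have hST : S = T * (b₂ + b₃) := Subtype.ext (by
    push_cast
    rw [hS', hT']
    linear_combination -(u : K) ^ 2 * x₃ * hb₂ - (u : K) ^ 2 * x₂ * hb₃)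
  have h0 := congr_arg ρ hST
  rw [hS] at h0
  simp [hb₂0, hb₃0, hu0] at h0

variable [DecidableEq k]

/-- Two integral points on a line of non-integral slope have opposite reductions: multiplying the
slope by `x₁ - x₂`, or by `y₁ - y(-P₂)`, gives an integral element, so both of these reduce to
`0`. -/
theorem red_add_red_eq_zero {ℓ μ x₁ x₂ x₃ y₁ y₂ : K} (h : LineSection (W⁄K) ℓ μ x₁ x₂ x₃)
    (h₁ : (W⁄K).Nonsingular x₁ y₁) (h₂ : (W⁄K).Nonsingular x₂ y₂)
    (e₁ : y₁ = ℓ * x₁ + μ) (e₂ : y₂ = ℓ * x₂ + μ) (hℓ : ℓ ∉ A) (hx₁ : x₁ ∈ A) (hx₂ : x₂ ∈ A) :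
    red ρ hΔ (.some x₁ y₁ h₁) + red ρ hΔ (.some x₂ y₂ h₂) = 0 := by
  have key := h.slope_mul_eq
  rw [← e₁, ← e₂] at key
  have hy₁ := y_mem_of_equation ρ W h₁.1 hx₁
  have hy₂ := y_mem_of_equation ρ W h₂.1 hx₂
  rw [red_some_of_mem ρ hΔ _ hx₁, red_some_of_mem ρ hΔ _ hx₂]
  lift x₁ to A using hx₁
  lift x₂ to A using hx₂
  lift y₁ to A using hy₁
  lift y₂ to A using hy₂
  simp only [negY, baseChange_a₁, baseChange_a₂, baseChange_a₃, baseChange_a₄] at key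
  refine Point.add_of_Y_eq ?_ ?_
  · rw [res_coe, res_coe, ← sub_eq_zero, ← map_sub]
    refine map_eq_zero_of_mul_eq ρ hℓ (w := y₁ - y₂) ?_
    push_cast
    rw [e₁, e₂]
    ring
  · simp only [res_coe, negY, baseChange_a₁, baseChange_a₃]
    have := map_eq_zero_of_mul_eq ρ hℓ (u := y₁ - (-y₂ - W.a₁ * x₂ - W.a₃))
      (w := x₁ ^ 2 + x₁ * x₂ + x₂ ^ 2 + W.a₂ * (x₁ + x₂) + W.a₄ - W.a₁ * y₁)
      (by push_cast; exact key)
    simpa [sub_eq_zero] using this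

/-- Reduction preserves the relation of having sum zero for affine points of which one is
integral. If the slope is integral, then the whole line reduces; otherwise one point reduces to
infinity and the other two to opposite points. -/
theorem red_add_add_of_mem {ℓ μ x₁ x₂ x₃ y₁ y₂ y₃ : K} (h : LineSection (W⁄K) ℓ μ x₁ x₂ x₃)
    (h₁ : (W⁄K).Nonsingular x₁ y₁) (h₂ : (W⁄K).Nonsingular x₂ y₂) (h₃ : (W⁄K).Nonsingular x₃ y₃)
    (e₁ : y₁ = ℓ * x₁ + μ) (e₂ : y₂ = ℓ * x₂ + μ) (e₃ : y₃ = ℓ * x₃ + μ) (hx₁ : x₁ ∈ A) :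
    red ρ hΔ (.some x₁ y₁ h₁) + red ρ hΔ (.some x₂ y₂ h₂) + red ρ hΔ (.some x₃ y₃ h₃) = 0 := by
  have hy₁ := y_mem_of_equation ρ W h₁.1 hx₁
  by_cases hℓ : ℓ ∈ A
  · have hμ : μ ∈ A := by
      rw [show μ = y₁ - ℓ * x₁ by rw [e₁]; ring]
      exact sub_mem hy₁ (mul_mem hℓ hx₁)
    have hroot {z z' z'' : K} (hz : LineSection (W⁄K) ℓ μ z z' z'') : z ∈ A := by
      lift ℓ to A using hℓ
      lift μ to A using hμ
      refine mem_of_cubic ρ (c₂ := ℓ ^ 2 + W.a₁ * ℓ - W.a₂)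
        (c₁ := -(W.a₄ - W.a₁ * μ - 2 * ℓ * μ - W.a₃ * ℓ)) (c₀ := μ ^ 2 + W.a₃ * μ - W.a₆) ?_
      have := hz.cubic_eq
      simp only [baseChange_a₁, baseChange_a₂, baseChange_a₃, baseChange_a₄, baseChange_a₆] at this
      push_cast
      linear_combination this
    have hx₂ := hroot h.swap₁₂
    have hx₃ := hroot h.swap₂₃.swap₁₂
    have hy₂ := y_mem_of_equation ρ W h₂.1 hx₂
    have hy₃ := y_mem_of_equation ρ W h₃.1 hx₃
    rw [red_some_of_mem ρ hΔ _ hx₁, red_some_of_mem ρ hΔ _ hx₂, red_some_of_mem ρ hΔ _ hx₃]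
    lift x₁ to A using hx₁
    lift x₂ to A using hx₂
    lift x₃ to A using hx₃
    lift y₁ to A using hy₁
    lift y₂ to A using hy₂
    lift y₃ to A using hy₃
    lift ℓ to A using hℓ
    lift μ to A using hμ
    have e₁' : y₁ = ℓ * x₁ + μ := Subtype.ext (by push_cast; exact e₁)
    have e₂' : y₂ = ℓ * x₂ + μ := Subtype.ext (by push_cast; exact e₂)
    have e₃' : y₃ = ℓ * x₃ + μ := Subtype.ext (by push_cast; exact e₃)
    have f₁ := h.sum_eq
    have f₂ := h.sum_mul_eq
    have f₃ := h.mul_eq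
    simp only [baseChange_a₁, baseChange_a₂, baseChange_a₃, baseChange_a₄,
      baseChange_a₆] at f₁ f₂ f₃
    have f₁' : x₁ + x₂ + x₃ = ℓ ^ 2 + W.a₁ * ℓ - W.a₂ := Subtype.ext (by push_cast; exact f₁)
    have f₂' : x₁ * x₂ + x₁ * x₃ + x₂ * x₃ = W.a₄ - W.a₁ * μ - 2 * ℓ * μ - W.a₃ * ℓ :=
      Subtype.ext (by push_cast; exact f₂)
    have f₃' : x₁ * x₂ * x₃ = μ ^ 2 + W.a₃ * μ - W.a₆ := Subtype.ext (by push_cast; exact f₃)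
    refine add_add_eq_zero_of_lineSection (ℓ := ρ ℓ) (μ := ρ μ) ⟨?_, ?_, ?_⟩ _ _ _ ?_ ?_ ?_
    · simpa using congr_arg ρ f₁'
    · simpa using congr_arg ρ f₂'
    · simpa using congr_arg ρ f₃'
    · simpa using congr_arg ρ e₁'
    · simpa using congr_arg ρ e₂'
    · simpa using congr_arg ρ e₃'
  · have hor : x₂ ∈ A ∨ x₃ ∈ A := by
      lift x₁ to A using hx₁
      lift y₁ to A using hy₁
      refine mem_or_mem_of_lineSection ρ (W := W) (ℓ := ℓ) (x₁ := x₁) (y₁ := y₁) ?_ hℓ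
      rwa [e₁, add_sub_cancel_left]
    have hthird {z z' : K} (hz : LineSection (W⁄K) ℓ μ x₁ z z') (hzA : z ∈ A) : z' ∉ A := by
      intro hz'
      lift x₁ to A using hx₁
      lift z to A using hzA
      lift z' to A using hz'
      refine hℓ (mem_of_quadratic ρ (c₁ := -W.a₁) (c₀ := W.a₂ + x₁ + z + z') ?_)
      have := hz.sum_eq
      simp only [baseChange_a₁, baseChange_a₂] at this
      push_cast
      linear_combination -this
    rcases hor with hx₂ | hx₃
    · rw [red_some_of_notMem ρ hΔ h₃ (hthird h hx₂), add_zero]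
      exact red_add_red_eq_zero ρ hΔ h h₁ h₂ e₁ e₂ hℓ hx₁ hx₂
    · rw [red_some_of_notMem ρ hΔ h₂ (hthird h.swap₂₃ hx₃), add_zero]
      exact red_add_red_eq_zero ρ hΔ h.swap₂₃ h₁ h₃ e₁ e₃ hℓ hx₁ hx₃

variable [DecidableEq K]

theorem red_add_add {T₁ T₂ T₃ : (W⁄K).Point} (h : T₁ + T₂ + T₃ = 0) :
    red ρ hΔ T₁ + red ρ hΔ T₂ + red ρ hΔ T₃ = 0 := by
  rcases T₁ with _ | ⟨x₁, y₁, h₁⟩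
  · rw [← Point.zero_def, zero_add] at h
    rw [← Point.zero_def, red_zero, zero_add, eq_neg_of_add_eq_zero_left h, red_neg, neg_add_cancel]
  rcases T₂ with _ | ⟨x₂, y₂, h₂⟩
  · rw [← Point.zero_def, add_zero] at h
    rw [← Point.zero_def, red_zero, add_zero, eq_neg_of_add_eq_zero_left h, red_neg, neg_add_cancel]
  rcases T₃ with _ | ⟨x₃, y₃, h₃⟩
  · rw [← Point.zero_def, add_zero] at h
    rw [← Point.zero_def, red_zero, add_zero, eq_neg_of_add_eq_zero_left h, red_neg, neg_add_cancel]
  obtain ⟨ℓ, μ, hL, e₁, e₂, e₃⟩ := exists_lineSection h₁ h₂ h₃ h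
  by_cases hx₁ : x₁ ∈ A
  · exact red_add_add_of_mem ρ hΔ hL h₁ h₂ h₃ e₁ e₂ e₃ hx₁
  by_cases hx₂ : x₂ ∈ A
  · rw [← red_add_add_of_mem ρ hΔ hL.swap₁₂ h₂ h₁ h₃ e₂ e₁ e₃ hx₂]
    abel
  by_cases hx₃ : x₃ ∈ A
  · rw [← red_add_add_of_mem ρ hΔ hL.swap₂₃.swap₁₂ h₃ h₁ h₂ e₃ e₁ e₂ hx₃]
    abel
  rw [red_some_of_notMem ρ hΔ _ hx₁, red_some_of_notMem ρ hΔ _ hx₂, red_some_of_notMem ρ hΔ _ hx₃,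
    add_zero, add_zero]

/-- Reduction of points as a group homomorphism. -/
noncomputable def redHom : (W⁄K).Point →+ (W⁄k).Point where
  toFun := red ρ hΔ
  map_zero' := rfl
  map_add' T₁ T₂ := by
    have := red_add_add ρ hΔ (add_neg_cancel (T₁ + T₂))
    rw [red_neg, add_neg_eq_zero] at this
    exact this.symm

/-- Reduction is injective on the `2`-power torsion when `2 ≠ 0` in `k`. A nonzero element of the
kernel would have a multiple of order `2`, whose `x`-coordinate is non-integral; but it is a root of
`4 x³ + b₂ x² + 2 b₄ x + b₆`, whose leading coefficient is a unit. -/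
theorem eq_zero_of_redHom_eq_zero (h2 : (2 : k) ≠ 0) (r : ℕ) {T : (W⁄K).Point}
    (hT : 2 ^ r • T = 0) (h : redHom ρ hΔ T = 0) : T = 0 := by
  induction r with
  | zero => simpa using hT
  | succ r ih =>
    refine ih ?_
    by_contra hne
    have hS : redHom ρ hΔ (2 ^ r • T) = 0 := by rw [map_nsmul, h, smul_zero]
    have hS2 : 2 ^ r • T + 2 ^ r • T = 0 := by rw [← two_nsmul, ← mul_nsmul', ← pow_succ', hT]
    rcases hTe : 2 ^ r • T with _ | ⟨x, y, hxy⟩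
    · exact hne hTe
    rw [hTe] at hS hS2
    have hx : x ∉ A := fun hx => by
      have : redHom ρ hΔ (.some x y hxy) = _ := red_some_of_mem ρ hΔ hxy hx
      rw [this] at hS
      exact Point.some_ne_zero _ hS
    rw [add_eq_zero_iff_eq_neg, Point.neg_some, Point.some.injEq] at hS2
    have hy := hS2.2
    have he := (equation_iff ..).1 hxy.1
    simp only [negY, baseChange_a₁, baseChange_a₂, baseChange_a₃, baseChange_a₄,
      baseChange_a₆] at hy he
    obtain ⟨b, hb, hb0⟩ := exists_mul_eq_one ρ hx
    -- The cubic of the `2`-torsion, divided by `x ^ 3`.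
    have h4 : (4 : A) + (W.a₁ ^ 2 + 4 * W.a₂) * b + (4 * W.a₄ + 2 * W.a₁ * W.a₃) * b ^ 2
        + (W.a₃ ^ 2 + 4 * W.a₆) * b ^ 3 = 0 := Subtype.ext (by
      have h4' : 4 * x ^ 3 + (W.a₁ ^ 2 + 4 * W.a₂) * x ^ 2 + (4 * W.a₄ + 2 * W.a₁ * W.a₃) * x
          + (W.a₃ ^ 2 + 4 * W.a₆) = 0 := by
        linear_combination -4 * he + (2 * y + W.a₁ * x + W.a₃) * hy
      push_cast
      linear_combination (b : K) ^ 3 * h4'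
        - (4 * (x ^ 2 * b ^ 2 + x * b + 1) + (W.a₁ ^ 2 + 4 * W.a₂) * b * (x * b + 1)
          + (4 * W.a₄ + 2 * W.a₁ * W.a₃) * b ^ 2) * hb)
    have := congr_arg ρ h4
    simp only [map_add, map_mul, map_pow, hb0, map_ofNat_valuationSubring, map_zero] at this
    exact h2 (pow_eq_zero_iff two_ne_zero |>.1 (by linear_combination this : (2 : k) ^ 2 = 0))

end Reduction

/-! ### Bounding the `2`-power torsion -/

section TorsionBound

/-- There are at most four points killed by `2`: infinity, and one point for each of the at most
three roots of the `2`-torsion polynomial. The bound is stated for finite sets of points, which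
avoids a finiteness hypothesis. -/
theorem card_two_torsion_le {F : Type*} [Field F] [DecidableEq F] (W : Affine F)
    (h2 : (2 : F) ≠ 0) (s : Finset W.Point) (hs : ∀ T ∈ s, 2 • T = 0) : s.card ≤ 4 := by
  have h4 : (W.twoTorsionPolynomial).a ≠ 0 := by
    have : (4 : F) = 2 ^ 2 := by norm_num
    simpa [WeierstrassCurve.twoTorsionPolynomial, this] using h2
  classical
  set t : Finset (Fin 2 → F) :=
    insert ![1, 0] ((W.twoTorsionPolynomial.roots.toFinset).image fun x : F => ![x, 1])
  have ht : t.card ≤ 4 := by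
    refine (Finset.card_insert_le _ _).trans (Nat.succ_le_succ ?_)
    exact Finset.card_image_le.trans Cubic.card_roots_le
  refine (Finset.card_le_card_of_injOn Point.xRep (fun T hT => ?_) fun T _ S hS h => ?_).trans ht
  · have h0 := hs T hT
    rcases T with _ | ⟨x, y, h⟩
    · exact Finset.mem_insert_self _ _
    · refine Finset.mem_insert_of_mem (Finset.mem_image.2 ⟨x, ?_, rfl⟩)
      rw [Multiset.mem_toFinset, Cubic.mem_roots_iff (Cubic.ne_zero_of_a_ne_zero h4)]
      rw [two_nsmul, add_eq_zero_iff_eq_neg, Point.neg_some, Point.some.injEq] at h0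
      have hy := h0.2
      have he := (equation_iff ..).1 h.1
      simp only [negY] at hy
      simp only [WeierstrassCurve.twoTorsionPolynomial, b₂, b₄, b₆]
      linear_combination -4 * he + (2 * y + W.a₁ * x + W.a₃) * hy
  · rcases Point.eq_or_eq_neg_of_xRep_eq_xRep h with h | h
    · exact h
    · have := hs S hS
      rw [two_nsmul, add_eq_zero_iff_eq_neg] at this
      rw [h, ← this]

theorem card_two_pow_torsion_le {G : Type*} [AddCommGroup G] [DecidableEq G] {c : ℕ}
    (h : ∀ s : Finset G, (∀ T ∈ s, 2 • T = 0) → s.card ≤ c) (r : ℕ) (s : Finset G)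
    (hs : ∀ T ∈ s, 2 ^ r • T = 0) : s.card ≤ c ^ r := by
  induction r generalizing s with
  | zero =>
    rw [pow_zero, Finset.card_le_one]
    intro a ha b hb
    simpa using (hs a ha).trans (hs b hb).symm
  | succ r ih =>
    have h1 : (s.image fun T => 2 • T).card ≤ c ^ r := ih _ fun T hT => by
      obtain ⟨S, hS, rfl⟩ := Finset.mem_image.1 hT
      rw [← mul_nsmul', ← pow_succ, hs S hS]
    refine (Finset.card_le_mul_card_image s c fun T hT => ?_).trans
      ((Nat.mul_le_mul_left c h1).trans_eq (pow_succ' c r).symm)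
    obtain ⟨S, hS, rfl⟩ := Finset.mem_image.1 hT
    rw [← Finset.card_image_of_injective _ (sub_left_injective (b := S))]
    refine h _ fun U hU => ?_
    obtain ⟨V, hV, rfl⟩ := Finset.mem_image.1 hU
    rw [nsmul_sub, (Finset.mem_filter.1 hV).2, sub_self]

end TorsionBound

/-! ### Odd order and the Frobenius in abstract groups -/

section Groups

/-- The group-theoretic core. Here `R` is the reduction map, `s` a Frobenius element and `F` the
Frobenius endomorphism of the reduced group, and `R` identifies the `2 ^ r`-torsion on both sides.
Elements of the `2 ^ r`-torsion fixed by `F` lift to elements fixed by `s`, so by `hfix` no element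
fixed by `F` has order `2 ^ r`, and those of `2`-power order are killed by `2 ^ r`. Hence
`2 ^ h • R (2 ^ r • β)` has odd order if and only if it is `2 ^ r` times an element fixed
by `F`, and such an element is the reduction of some `2 ^ h • β + g` with `g` a torsion element and
`2 ^ h • β + g` fixed by `s`. -/
theorem odd_addOrderOf_iff_of_equivariant {G H : Type*} [AddCommGroup G] [AddCommGroup H]
    (R : G →+ H) (s : G →+ G) (F : H →+ H) (hF : ∀ g, R (s g) = F (R g)) (r : ℕ)
    (hinj : ∀ g, 2 ^ r • g = 0 → R g = 0 → g = 0)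
    (hsurj : ∀ Q, 2 ^ r • Q = 0 → ∃ g, 2 ^ r • g = 0 ∧ R g = Q)
    (hfix : ∀ g, 2 ^ r • g = 0 → s g = g → 2 ^ (r - 1) • g = 0) (hr : r ≠ 0)
    (β : G) (hβ : s (2 ^ r • β) = 2 ^ r • β) (hfin : IsOfFinAddOrder (R (2 ^ r • β))) (h : ℕ) :
    Odd (addOrderOf (2 ^ h • R (2 ^ r • β))) ↔
      ∃ g, 2 ^ r • g = 0 ∧ 2 ^ h • (s β - β) = g - s g := by
  constructor
  · intro hodd
    -- If `X` has order `2 * j + 1`, then `j + 1` inverts `2` on the multiples of `X`.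
    set X := 2 ^ h • R (2 ^ r • β) with hX
    obtain ⟨j, hj⟩ := hodd
    have hX2 : 2 • (j + 1) • X = X := by
      have h0 := addOrderOf_nsmul_eq_zero X
      rw [hj] at h0
      rw [← mul_nsmul', show 2 * (j + 1) = 2 * j + 1 + 1 by ring, succ_nsmul, h0, zero_add]
    have hXn (n : ℕ) : 2 ^ n • (j + 1) ^ n • X = X := by
      induction n with
      | zero => simp
      | succ n ih =>
        rw [← mul_nsmul', pow_succ, pow_succ, mul_mul_mul_comm, mul_nsmul', mul_nsmul' _ 2, hX2,
          mul_nsmul', ih]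
    have hFX : F X = X := by rw [hX, map_nsmul, ← hF, hβ]
    set Q := (j + 1) ^ r • X with hQ
    have hFQ : F Q = Q := by rw [hQ, map_nsmul, hFX]
    obtain ⟨g, hg, hgQ⟩ := hsurj (Q - R (2 ^ h • β)) (by
      rw [nsmul_sub, hXn, hX, ← map_nsmul, ← map_nsmul, nsmul_left_comm, sub_self])
    refine ⟨g, hg, ?_⟩
    have hsub : 2 ^ r • (s β - β) = 0 := by rw [nsmul_sub, ← map_nsmul, hβ, sub_self]
    refine sub_eq_zero.1 (hinj _ ?_ ?_)
    · rw [nsmul_sub, nsmul_left_comm, hsub, nsmul_zero, nsmul_sub, ← map_nsmul, hg, map_zero,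
        sub_self, sub_self]
    · have e : 2 ^ h • (s β - β) - (g - s g) = s (2 ^ h • β + g) - (2 ^ h • β + g) := by
        rw [map_add, map_nsmul, nsmul_sub]
        abel
      rw [e, map_sub, hF, map_add, hgQ, add_sub_cancel, hFQ, sub_self]
  · rintro ⟨g, hg, hgβ⟩
    set Q := R (2 ^ h • β + g) with hQ
    have hs : s (2 ^ h • β + g) = 2 ^ h • β + g := by
      rw [nsmul_sub, sub_eq_sub_iff_add_eq_add] at hgβ
      rw [map_add, map_nsmul, hgβ, add_comm]
    have hFQ : F Q = Q := by rw [hQ, ← hF, hs]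
    have hrQ : 2 ^ r • Q = 2 ^ h • R (2 ^ r • β) := by
      rw [hQ, ← map_nsmul, nsmul_add, hg, add_zero, nsmul_left_comm, map_nsmul]
    have hstep (Y : H) (hY : F Y = Y) (hY2 : 2 ^ r • Y = 0) : 2 ^ (r - 1) • Y = 0 := by
      obtain ⟨g', hg', rfl⟩ := hsurj Y hY2
      rw [← map_nsmul, hfix g' hg' ?_, map_zero]
      refine sub_eq_zero.1 (hinj _ ?_ ?_)
      · rw [nsmul_sub, ← map_nsmul, hg', map_zero, sub_self]
      · rw [map_sub, hF, hY, sub_self]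
    -- The elements of `2`-power order fixed by `F` are killed by `2 ^ r`.
    have hdesc (a : ℕ) : ∀ Y, F Y = Y → 2 ^ a • Y = 0 → 2 ^ r • Y = 0 := by
      induction a with
      | zero => intro Y _ hY; rw [pow_zero, one_nsmul] at hY; rw [hY, nsmul_zero]
      | succ a ih =>
        intro Y hFY hY
        have h2 := ih (2 • Y) (by rw [map_nsmul, hFY]) (by rw [← mul_nsmul', ← pow_succ, hY])
        rw [nsmul_left_comm, ← mul_nsmul', ← pow_succ'] at h2
        have h3 := hstep (2 • Y) (by rw [map_nsmul, hFY]) (by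
          rw [← mul_nsmul', ← pow_succ, h2])
        rwa [← mul_nsmul', ← pow_succ, Nat.sub_add_cancel (Nat.pos_of_ne_zero hr)] at h3
    rw [← hrQ]
    have hfinQ : IsOfFinAddOrder Q := by
      have : IsOfFinAddOrder (2 ^ r • Q) := hrQ ▸ hfin.nsmul
      exact (isOfFinAddOrder_nsmul.1 this).resolve_right (by simp)
    obtain ⟨a, m, hm, ham⟩ := Nat.exists_eq_two_pow_mul_odd hfinQ.addOrderOf_pos.ne'
    have h0 : 2 ^ r • m • Q = 0 := hdesc a _ (by rw [map_nsmul, hFQ]) (by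
      rw [← mul_nsmul', ← ham, addOrderOf_nsmul_eq_zero])
    rw [nsmul_left_comm] at h0
    exact hm.of_dvd_nat (addOrderOf_dvd_of_nsmul_eq_zero h0)

end Groups

/-! ### Matrices over `ℤ/2 ^ r` -/

section Matrices

theorem two_pow_pred_mul_eq_zero {r : ℕ} {a d : ZMod (2 ^ r)} (hd : d ≠ 0) (h : a * d = 0) :
    2 ^ (r - 1) * a = 0 := by
  rcases Nat.eq_zero_or_pos r with rfl | hr
  · exact Subsingleton.elim (α := ZMod 1) _ _
  have : NeZero (2 ^ r) := ⟨by positivity⟩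
  -- Either `a` is a multiple of `2`, or it is a unit and then `d = 0`.
  rcases Nat.even_or_odd' a.val with ⟨b, hb | hb⟩
  · have : a = 2 * (b : ZMod (2 ^ r)) := by
      rw [← ZMod.natCast_zmod_val a, hb]; push_cast; rfl
    have h2 : (2 : ZMod (2 ^ r)) ^ r = 0 := by
      exact_mod_cast ZMod.natCast_self (2 ^ r)
    rw [this, ← mul_assoc, ← pow_succ, Nat.sub_add_cancel hr, h2, zero_mul]
  · refine absurd ?_ hd
    have hu : IsUnit a := by
      rw [← ZMod.natCast_zmod_val a, ZMod.isUnit_iff_coprime, hb]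
      exact Nat.Coprime.pow_right r (by simp)
    exact hu.mul_right_eq_zero.1 h

theorem mul_det_eq_zero_of_vecMul_eq_zero {R : Type*} [CommRing R] {N : Matrix (Fin 2) (Fin 2) R}
    {x : Fin 2 → R} (h : x ᵥ* N = 0) (i : Fin 2) : x i * N.det = 0 := by
  -- Multiply by the adjugate.
  have : x ᵥ* N ᵥ* N.adjugate = 0 := by rw [h, Matrix.zero_vecMul]
  rw [Matrix.vecMul_vecMul, Matrix.mul_adjugate, Matrix.vecMul_smul, Matrix.vecMul_one] at this
  simpa [mul_comm] using congr_fun this i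

end Matrices

/-! ### `K_r` is a number field -/

section Algebraic

theorem isAlgebraic_of_quartic {k L : Type*} [Field k] [Field L] [Algebra k L]
    {x c₃ c₂ c₁ c₀ : L} (h₃ : IsAlgebraic k c₃) (h₂ : IsAlgebraic k c₂)
    (h₁ : IsAlgebraic k c₁) (h₀ : IsAlgebraic k c₀)
    (h : x ^ 4 = c₃ * x ^ 3 + c₂ * x ^ 2 + c₁ * x + c₀) : IsAlgebraic k x := by
  have hx : IsAlgebraic (algebraicClosure k L) x := by
    let d₃ : algebraicClosure k L := ⟨c₃, mem_algebraicClosure_iff.2 h₃⟩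
    let d₂ : algebraicClosure k L := ⟨c₂, mem_algebraicClosure_iff.2 h₂⟩
    let d₁ : algebraicClosure k L := ⟨c₁, mem_algebraicClosure_iff.2 h₁⟩
    let d₀ : algebraicClosure k L := ⟨c₀, mem_algebraicClosure_iff.2 h₀⟩
    open Polynomial in
    refine ⟨X ^ 4 - (C d₃ * X ^ 3 + C d₂ * X ^ 2 + C d₁ * X + C d₀), ?_, ?_⟩
    · refine (Polynomial.monic_X_pow_sub ?_).ne_zero
      compute_degree!
    · simp only [map_sub, map_add, map_mul, map_pow, Polynomial.aeval_X, Polynomial.aeval_C]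
      exact sub_eq_zero.2 h
  exact hx.restrictScalars k

/-- The affine coordinates of a point, if it has any, are algebraic numbers. -/
def HasAlgebraicCoords (T : Pts ℂ) : Prop :=
  ∀ x y hxy, T = .some x y hxy → IsAlgebraic ℚ x ∧ IsAlgebraic ℚ y

/-- Halving a point preserves algebraicity: `x` is a root of the `2`-torsion polynomial, or it
satisfies the duplication formula `x⁴ + 4x² + 4 = x' (4x³ + 5x² - 8x)`, where `x'` is the
`x`-coordinate of the double. -/
theorem HasAlgebraicCoords.of_two_nsmul {T : Pts ℂ} (h : HasAlgebraicCoords (2 • T)) :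
    HasAlgebraicCoords T := by
  rintro x y hxy rfl
  have he := (equation_iff ..).1 hxy.1
  simp only [baseChange_a₁, baseChange_a₂, baseChange_a₃, baseChange_a₄, baseChange_a₆, E] at he
  push_cast at he
  have hq (q : ℚ) : IsAlgebraic ℚ (q : ℂ) := isAlgebraic_algebraMap q
  have hx : IsAlgebraic ℚ x := by
    rcases hd : 2 • Point.some x y hxy with _ | ⟨x', y', hxy'⟩
    · have h0 : Point.some x y hxy + Point.some x y hxy = 0 := by rw [← two_nsmul]; exact hd
      rw [add_eq_zero_iff_eq_neg, Point.neg_some, Point.some.injEq] at h0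
      have hy := h0.2
      simp only [negY, baseChange_a₁, baseChange_a₃, E] at hy
      push_cast at hy
      refine isAlgebraic_of_quartic (hq (-5 / 4)) (hq 2) (hq 0) (hq 0) ?_
      push_cast
      linear_combination (x / 4) * (-4 * he + (2 * y + x) * hy)
    · obtain ⟨hx', -⟩ := h _ _ _ hd
      have h0 : Point.some x y hxy + Point.some x y hxy + -Point.some x' y' hxy' = 0 := by
        rw [← two_nsmul, hd, add_neg_cancel]
      rw [Point.neg_some] at h0
      obtain ⟨ℓ, μ, hL, hy, -, -⟩ := exists_lineSection _ _ _ h0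
      have hs := hL.slope_mul_eq
      have hsum := hL.sum_eq
      rw [← hy] at hs
      simp only [negY, baseChange_a₁, baseChange_a₂, baseChange_a₃, baseChange_a₄, E] at hs hsum
      push_cast at hs hsum
      have key : x ^ 4 + 4 * x ^ 2 + 4 = x' * (4 * x ^ 3 + 5 * x ^ 2 - 8 * x) := by
        have hs' : ℓ * (2 * y + x) = 3 * x ^ 2 + 2 * x - 2 - y := by linear_combination hs
        have hψ : (2 * y + x) ^ 2 = 4 * x ^ 3 + 5 * x ^ 2 - 8 * x := by linear_combination 4 * he
        rw [← hψ]
        linear_combination -(2 * y + x) ^ 2 * hsum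
          - (ℓ * (2 * y + x) + (3 * x ^ 2 + 2 * x - 2 - y) + (2 * y + x)) * hs' + (5 + 8 * x) * he
      refine isAlgebraic_of_quartic (((hq 4)).mul hx') (((hq 5).mul hx').sub (hq 4))
        ((hq (-8)).mul hx') (hq (-4)) ?_
      push_cast
      linear_combination key
  refine ⟨hx, isAlgebraic_of_quartic hx.neg
    (((hx.pow 3).add (hx.pow 2)).sub ((hq 2).mul hx)) (hq 0) (hq 0) ?_⟩
  push_cast
  linear_combination y ^ 2 * he

theorem HasAlgebraicCoords.of_two_pow_nsmul (r : ℕ) {T : Pts ℂ}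
    (h : HasAlgebraicCoords (2 ^ r • T)) : HasAlgebraicCoords T := by
  induction r generalizing T with
  | zero => simpa using h
  | succ r ih =>
    refine (ih ?_).of_two_nsmul
    rwa [← mul_nsmul', ← pow_succ]

theorem hasAlgebraicCoords_PC : HasAlgebraicCoords PC := by
  intro x y hxy h
  rw [PC, P, Point.some.injEq] at h
  obtain ⟨rfl, rfl⟩ := h
  have := isAlgebraic_algebraMap (R := ℚ) (A := ℂ) 2
  simpa using this

namespace Frame

variable {r : ℕ} (φ : Frame r)

include φ in
theorem finite_tors : Finite (Tors r) := by
  have : NeZero (2 ^ r) := ⟨by positivity⟩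
  exact Finite.of_equiv _ φ.basis.equivFun.toEquiv.symm

include φ in
theorem natCard_tors : Nat.card (Tors r) = 4 ^ r := by
  rw [Nat.card_congr φ.basis.equivFun.toEquiv]
  simp [← pow_mul, mul_comm r 2, pow_mul 2 2 r]

include φ in
/-- The points `β` with `2 ^ r • β = P` form a coset of the finite group `E[2 ^ r]`. -/
theorem finite_preimages : {T : Pts ℂ | 2 ^ r • T = PC}.Finite := by
  have := φ.finite_tors
  refine (Set.finite_range fun T : Tors r => φ.β + (T : Pts ℂ)).subset fun T hT => ?_
  refine ⟨⟨T - φ.β, mem_Tors.2 ?_⟩, add_sub_cancel _ _⟩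
  rw [nsmul_sub, φ.hβ, Set.mem_ofPred.1 hT, sub_self]

include φ in
theorem finiteDimensional : FiniteDimensional ℚ (K r) := by
  have hfin : {z : ℂ | ∃ (x y : ℂ) (hxy : (E⁄ℂ).Nonsingular x y),
      2 ^ r • (Point.some x y hxy : Pts ℂ) = PC ∧ (z = x ∨ z = y)}.Finite := by
    let X : Pts ℂ → ℂ := fun T => match T with | .zero => 0 | .some x _ _ => x
    let Y : Pts ℂ → ℂ := fun T => match T with | .zero => 0 | .some _ y _ => y
    refine ((φ.finite_preimages.image X).union (φ.finite_preimages.image Y)).subset ?_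
    rintro z ⟨x, y, hxy, h, rfl | rfl⟩
    · exact Or.inl ⟨_, h, rfl⟩
    · exact Or.inr ⟨_, h, rfl⟩
  have := hfin.to_subtype
  refine IntermediateField.finiteDimensional_adjoin ?_
  rintro z ⟨x, y, hxy, h, hz⟩
  have hT : HasAlgebraicCoords (.some x y hxy) :=
    .of_two_pow_nsmul r (by rw [h]; exact hasAlgebraicCoords_PC)
  obtain ⟨hx, hy⟩ := hT _ _ _ rfl
  rcases hz with rfl | rfl
  exacts [hx.isIntegral, hy.isIntegral]

end Frame

end Algebraic

/-! ### Frobenius elements on the local ring of a prime -/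

section Place

open IsDedekindDomain

variable {L : Type*} [Field L] [NumberField L] (v : HeightOneSpectrum (𝓞 L))

/-- The valuation ring of a number field at a finite place, that is, the localization of the ring of
integers at the corresponding prime ideal. -/
noncomputable abbrev place : ValuationSubring L := (v.valuation L).valuationSubring

theorem coe_mem_place (a : 𝓞 L) : (a : L) ∈ place v := v.valuation_le_one a

theorem residue_eq_zero_iff_mem (a : 𝓞 L) :
    IsLocalRing.residue (place v) ⟨a, coe_mem_place v a⟩ = 0 ↔ a ∈ v.asIdeal := by
  rw [IsLocalRing.residue_eq_zero_iff, ← ValuationSubring.coe_mem_nonunits_iff,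
    ValuationSubring.mem_nonunits_iff_or, Valuation.mem_valuationSubring_iff, map_inv₀,
    ← v.valuation_lt_one_iff_mem (K := L), not_le]
  rcases eq_or_ne (a : L) 0 with h | h
  · simp [h]
  · rw [or_iff_right h, one_lt_inv₀ ((Valuation.pos_iff _).2 h)]

variable {p : ℕ} {σ : Gal(L/ℚ)}
  (hσ : ∀ α : 𝓞 L, σ • α - α ^ p ∈ v.asIdeal)

include hσ in
/-- A Frobenius element preserves the local ring and acts on its residue field as `x ↦ x ^ p`. An
element of the local ring is a quotient `n / s` of algebraic integers with `s ∉ 𝔭`, and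
`σ s ≡ s ^ p` is again outside `𝔭`. -/
theorem frobenius_place (x : place v) : ∃ h : σ (x : L) ∈ place v,
    IsLocalRing.residue (place v) ⟨σ x, h⟩ = IsLocalRing.residue (place v) x ^ p := by
  obtain ⟨n, s, hns⟩ := v.exists_primeCompl_mul_eq_of_integer (K := L) x x.2
  let i : 𝓞 L →+* place v :=
    { toFun a := ⟨a, coe_mem_place v a⟩
      map_one' := rfl
      map_mul' _ _ := rfl
      map_zero' := rfl
      map_add' _ _ := rfl }
  have hi (a : 𝓞 L) : IsLocalRing.residue _ (i (σ • a)) = IsLocalRing.residue _ (i a) ^ p := by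
    rw [← map_pow, ← map_pow, ← sub_eq_zero, ← map_sub, ← map_sub]
    exact (residue_eq_zero_iff_mem v _).2 (hσ a)
  have hs0 : IsLocalRing.residue _ (i s) ≠ 0 := fun h => s.2 ((residue_eq_zero_iff_mem v _).1 h)
  have hσs0 : IsLocalRing.residue _ (i (σ • (s : 𝓞 L))) ≠ 0 := by
    rw [hi]; exact pow_ne_zero p hs0
  obtain ⟨t, ht⟩ := (isUnit_of_map_unit (IsLocalRing.residue (place v)) _
    (isUnit_iff_ne_zero.2 hσs0)).exists_right_inv
  have hx : x * i s = i n := Subtype.ext hns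
  have hσx : σ (x : L) * (i (σ • (s : 𝓞 L)) : L) = (i (σ • n) : L) := by
    have := congr_arg σ hns
    rw [map_mul] at this
    exact this
  have hmem : σ (x : L) = ((i (σ • n) * t : place v) : L) := by
    have ht' : (i (σ • (s : 𝓞 L)) : L) * t = 1 := congr_arg Subtype.val ht
    push_cast
    rw [← hσx, mul_assoc, ht', mul_one]
  refine ⟨hmem ▸ (i (σ • n) * t).2, ?_⟩
  have h1 : (⟨σ x, hmem ▸ (i (σ • n) * t).2⟩ : place v) * i (σ • (s : 𝓞 L)) = i (σ • n) :=
    Subtype.ext hσx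
  have h2 := congr_arg (IsLocalRing.residue _) h1
  have h3 := congr_arg (IsLocalRing.residue _) hx
  rw [map_mul, hi, hi, ← h3, map_mul, mul_pow] at h2
  exact mul_right_cancel₀ (pow_ne_zero p hs0) h2

end Place

/-! ### Points of `E` over varying fields -/

section Functoriality

/-- The homomorphism `E(F) → E(F')` induced by a field homomorphism `F → F'`. -/
noncomputable def mapPts {F F' : Type*} [Field F] [Field F'] [DecidableEq F] [DecidableEq F']
    (f : F →+* F') : Pts F →+ Pts F' :=
  Point.map (W' := E) (S := ℤ) f.toIntAlgHom

theorem mapPts_injective {F F' : Type*} [Field F] [Field F'] [DecidableEq F] [DecidableEq F']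
    (f : F →+* F') : Function.Injective (mapPts f) := Point.map_injective _

theorem mapPts_P {F F' : Type*} [Field F] [Field F'] [DecidableEq F] [DecidableEq F']
    (f : F →+* F') (h6 : (6 : F) ≠ 0) (h6' : (6 : F') ≠ 0) : mapPts f (P F h6) = P F' h6' := by
  simp only [mapPts, P, Point.map_some, Point.some.injEq]
  exact ⟨map_ofNat f 2, map_ofNat f 2⟩

instance finite_pts {F : Type*} [Field F] [Finite F] : Finite (Pts F) := by
  have : Finite (WithZero {xy : F × F // (E⁄F).Nonsingular xy.1 xy.2}) :=
    inferInstanceAs (Finite (Option _))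
  exact Finite.of_equiv _ (nonsingularPointEquiv (E⁄F)).symm

end Functoriality

theorem E_Δ : E.Δ = 612 := by
  simp [E, WeierstrassCurve.Δ, b₂, b₄, b₆, b₈]

theorem redHom_P {K k : Type*} [Field K] [Field k] [DecidableEq K] [DecidableEq k]
    {A : ValuationSubring K} (ρ : A →+* k) [IsLocalHom ρ] (hΔ : (E.Δ : k) ≠ 0)
    (h6 : (6 : K) ≠ 0) (h6' : (6 : k) ≠ 0) : redHom ρ hΔ (P K h6) = P k h6' := by
  refine (red_some_of_mem ρ hΔ (nonsingular_two_two h6) (2 : A).2).trans ?_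
  have h2 : res ρ (2 : K) = 2 := (res_coe ρ (2 : A)).trans (map_ofNat_valuationSubring ρ 2)
  simp only [P, Point.some.injEq]
  exact ⟨h2, h2⟩

/-! ### The `2`-part of the order of an element -/

section Order

theorem odd_addOrderOf_two_pow_nsmul_iff {G : Type*} [AddGroup G] {g : G}
    (hg : IsOfFinAddOrder g) (h : ℕ) :
    Odd (addOrderOf (2 ^ h • g)) ↔ padicValNat 2 (addOrderOf g) ≤ h := by
  constructor
  · intro hodd
    have h1 : addOrderOf g ∣ addOrderOf (2 ^ h • g) * 2 ^ h :=
      addOrderOf_dvd_of_nsmul_eq_zero (by rw [mul_nsmul', addOrderOf_nsmul_eq_zero])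
    have h2 := pow_padicValNat_dvd (p := 2) (n := addOrderOf g) |>.trans h1
    exact (Nat.pow_dvd_pow_iff_le_right (by norm_num)).1
      ((Nat.Coprime.pow_left _ (Nat.coprime_two_left.2 hodd)).dvd_of_dvd_mul_left h2)
  · intro hle
    obtain ⟨a, m, hm, ham⟩ := Nat.exists_eq_two_pow_mul_odd hg.addOrderOf_pos.ne'
    have ha : padicValNat 2 (addOrderOf g) = a := by
      rw [ham, padicValNat.mul (by positivity) hm.pos.ne', padicValNat.prime_pow,
        padicValNat.eq_zero_of_not_dvd hm.not_two_dvd_nat, add_zero]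
    rw [ha] at hle
    refine hm.of_dvd_nat (addOrderOf_dvd_of_nsmul_eq_zero ?_)
    rw [← mul_nsmul']
    refine addOrderOf_dvd_iff_nsmul_eq_zero.1 ?_
    rw [ham, mul_comm]
    exact mul_dvd_mul_left m (pow_dvd_pow 2 hle)

end Order

/-! ### The Galois action in coordinates -/

section Galois

theorem coe_gal_eq {r : ℕ} (σ : Gal(K r/ℚ)) {S : (toC r).range} {T : Pts (K r)}
    (h : toC r T = S) : (gal r σ S : Pts ℂ) = toC r (galK r σ T) := by
  obtain rfl : S = AddMonoidHom.ofInjective (toC_injective r) T := Subtype.ext h.symm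
  simp only [gal, AddMonoidHom.comp_apply, AddEquiv.coe_toAddMonoidHom, AddEquiv.symm_apply_apply]
  rfl

namespace Frame

variable {r : ℕ} (φ : Frame r) (σ : Gal(K r/ℚ))

theorem coe_shift {β : Pts (K r)} (hβ : toC r β = φ.β) :
    (φ.shift σ : Pts ℂ) = toC r (galK r σ β - β) := by
  rw [map_sub, hβ, ← coe_gal_eq σ (S := φ.betaK) hβ]
  rfl

theorem coe_torsAct {T : Tors r} {g : Pts (K r)} (h : toC r g = T) :
    (φ.torsAct σ T : Pts ℂ) = toC r (galK r σ g) :=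
  coe_gal_eq σ (S := φ.torsToRange T) h

theorem repr_torsAct (T : Tors r) :
    ⇑(φ.basis.repr (φ.torsAct σ T)) = φ.basis.repr T ᵥ* φ.mat σ := by
  rw [mat_eq, Matrix.vecMul_transpose, LinearMap.toMatrix_mulVec_repr]
  rfl

theorem repr_sub_torsAct (T : Tors r) :
    ⇑(φ.basis.repr (T - φ.torsAct σ T)) = φ.basis.repr T ᵥ* (1 - φ.mat σ) := by
  rw [map_sub, Finsupp.coe_sub, repr_torsAct, Matrix.vecMul_sub, Matrix.vecMul_one]

/-- The condition `2 ^ h v ∈ im (1 - M)` without coordinates: `2 ^ h (σ β - β) = T - σ T` for some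
`T ∈ E[2 ^ r]`. -/
theorem smul_vec_mem_rowImage_iff (h : ℕ) :
    (2 ^ h : ZMod (2 ^ r)) • φ.vec σ ∈ rowImage (1 - φ.mat σ) ↔
      ∃ T : Tors r, 2 ^ h • φ.shift σ = T - φ.torsAct σ T := by
  have hv : (2 ^ h : ZMod (2 ^ r)) • φ.vec σ = φ.basis.repr (2 ^ h • φ.shift σ) := by
    rw [map_nsmul, Finsupp.coe_nsmul, ← Nat.cast_smul_eq_nsmul (ZMod (2 ^ r))]
    push_cast
    rfl
  rw [hv, rowImage, LinearMap.mem_range]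
  constructor
  · rintro ⟨x, hx⟩
    refine ⟨φ.basis.equivFun.symm x, φ.basis.repr.injective (DFunLike.coe_injective ?_)⟩
    rw [repr_sub_torsAct, ← hx, Matrix.vecMulLinear_apply]
    congr 1
    exact (φ.basis.equivFun.apply_symm_apply x).symm
  · rintro ⟨T, hT⟩
    exact ⟨φ.basis.repr T, by rw [hT, repr_sub_torsAct, Matrix.vecMulLinear_apply]⟩

/-- If `det (1 - M) ≠ 0`, then no element of order exactly `2 ^ r` is fixed by `σ`. -/
theorem two_pow_pred_nsmul_eq_zero (hdet : (1 - φ.mat σ).det ≠ 0) {T : Tors r}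
    (hT : φ.torsAct σ T = T) : 2 ^ (r - 1) • T = 0 := by
  have h0 : φ.basis.repr T ᵥ* (1 - φ.mat σ) = 0 := by
    rw [← repr_sub_torsAct, hT, sub_self, map_zero]
    rfl
  refine φ.basis.repr.injective (Finsupp.ext fun i => ?_)
  have := two_pow_pred_mul_eq_zero hdet (mul_det_eq_zero_of_vecMul_eq_zero h0 i)
  rw [map_nsmul, Finsupp.coe_nsmul, Pi.smul_apply, nsmul_eq_mul, map_zero, Finsupp.zero_apply]
  exact_mod_cast this

include φ in
theorem exists_toC_eq (T : Tors r) : ∃ g : Pts (K r), 2 ^ r • g = 0 ∧ toC r g = T := by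
  obtain ⟨g, hg⟩ := φ.tors_mem_range T
  exact ⟨g, toC_injective r (by rw [map_nsmul, hg, mem_Tors.1 T.2, map_zero]), hg⟩

include φ in
/-- A homomorphism that is injective on `E[2 ^ r]`, into a group with at most `4 ^ r` elements
killed by `2 ^ r`, maps `E[2 ^ r]` onto the set of those elements. -/
theorem exists_two_pow_nsmul_eq_zero_of_map {H : Type*} [AddCommGroup H] (R : Pts (K r) →+ H)
    (hinj : ∀ g, 2 ^ r • g = 0 → R g = 0 → g = 0)
    (hcard : ∀ s : Finset H, (∀ Q ∈ s, 2 ^ r • Q = 0) → s.card ≤ 4 ^ r)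
    {Q : H} (hQ : 2 ^ r • Q = 0) : ∃ g, 2 ^ r • g = 0 ∧ R g = Q := by
  classical
  choose f hf0 hf using φ.exists_toC_eq
  have := φ.finite_tors
  have := Fintype.ofFinite (Tors r)
  have hRf : Function.Injective fun T => R (f T) := fun S T hST => by
    have : f S - f T = 0 := hinj _ (by rw [nsmul_sub, hf0, hf0, sub_self])
      (by rw [map_sub, sub_eq_zero]; exact hST)
    exact Subtype.ext (by rw [← hf, ← hf, sub_eq_zero.1 this])
  set s : Finset H := Finset.univ.image fun T => R (f T)
  have hs : s.card = 4 ^ r := by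
    rw [Finset.card_image_of_injective _ hRf, Finset.card_univ, ← Nat.card_eq_fintype_card,
      φ.natCard_tors]
  by_contra hne
  have hQs : Q ∉ s := fun h => by
    obtain ⟨T, -, hT⟩ := Finset.mem_image.1 h
    exact hne ⟨f T, hf0 T, hT⟩
  have := hcard (insert Q s) fun S hS => by
    rcases Finset.mem_insert.1 hS with rfl | hS
    · exact hQ
    · obtain ⟨T, -, rfl⟩ := Finset.mem_image.1 hS
      rw [← map_nsmul, hf0, map_zero]
  rw [Finset.card_insert_of_notMem hQs, hs] at this
  omega

end Frame

end Galois

/-! ### Reduction commutes with Frobenius -/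

section Frobenius

open IsDedekindDomain

variable {L : Type*} [Field L] [NumberField L] [DecidableEq L] (v : HeightOneSpectrum (𝓞 L))
  [DecidableEq (IsLocalRing.ResidueField (place v))]

theorem red_map_eq_map_frobenius_red {p : ℕ} [Fact p.Prime]
    [CharP (IsLocalRing.ResidueField (place v)) p] {σ : Gal(L/ℚ)}
    (hσ : ∀ α : 𝓞 L, σ • α - α ^ p ∈ v.asIdeal)
    (hΔ : (E.Δ : IsLocalRing.ResidueField (place v)) ≠ 0) (T : Pts L) :
    redHom (IsLocalRing.residue (place v)) hΔ
        (Point.map (W' := E) (S := ℚ) (σ : L →ₐ[ℚ] L) T) =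
      mapPts (frobenius _ p) (redHom (IsLocalRing.residue (place v)) hΔ T) := by
  rcases T with _ | ⟨x, y, h⟩
  · rfl
  by_cases hx : x ∈ place v
  · have hy := y_mem_of_equation (IsLocalRing.residue (place v)) E h.1 hx
    obtain ⟨hσx, ex⟩ := frobenius_place v hσ ⟨x, hx⟩
    obtain ⟨hσy, ey⟩ := frobenius_place v hσ ⟨y, hy⟩
    have e1 : redHom (IsLocalRing.residue (place v)) hΔ (.some x y h) = _ :=
      red_some_of_mem _ hΔ h hx
    have e2 (h' : (E⁄L).Nonsingular (σ x) (σ y)) :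
        redHom (IsLocalRing.residue (place v)) hΔ (.some (σ x) (σ y) h') = _ :=
      red_some_of_mem _ hΔ h' hσx
    rw [Point.map_some, e1]
    refine (e2 _).trans ?_
    simp only [mapPts, Point.map_some, Point.some.injEq]
    exact ⟨(res_coe _ (⟨σ x, hσx⟩ : place v)).trans
        (ex.trans (congr_arg (· ^ p) (res_coe _ (⟨x, hx⟩ : place v)).symm)),
      (res_coe _ (⟨σ y, hσy⟩ : place v)).trans
        (ey.trans (congr_arg (· ^ p) (res_coe _ (⟨y, hy⟩ : place v)).symm))⟩
  · have hσx : σ x ∉ place v := fun hσx => by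
      obtain ⟨b, hb, hb0⟩ := exists_mul_eq_one (IsLocalRing.residue (place v)) hx
      obtain ⟨hσb, eb⟩ := frobenius_place v hσ b
      have h1 : (⟨σ x, hσx⟩ : place v) * ⟨σ b, hσb⟩ = 1 := Subtype.ext (by
        have := congr_arg σ hb
        rwa [map_mul, map_one] at this)
      have h2 := congr_arg (IsLocalRing.residue (place v)) h1
      rw [map_mul, eb, hb0, zero_pow (Fact.out : p.Prime).ne_zero, mul_zero, map_one] at h2
      exact zero_ne_one h2
    have e1 : redHom (IsLocalRing.residue (place v)) hΔ (.some x y h) = 0 :=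
      red_some_of_notMem _ hΔ h hx
    have e2 (h' : (E⁄L).Nonsingular (σ x) (σ y)) :
        redHom (IsLocalRing.residue (place v)) hΔ (.some (σ x) (σ y) h') = 0 :=
      red_some_of_notMem _ hΔ h' hσx
    rw [Point.map_some, e1, map_zero]
    exact e2 _

end Frobenius

/-- For a Frobenius element `σ` at `𝔭 ∣ p`, the point `2 ^ h P` has odd order in `E(𝔽_p)` if and
only if `2 ^ h v` is in the row image of `1 - M`. The group-theoretic criterion is applied to the
reduction map from `E(K_r)` to the points over the residue field of `𝔭`, into which `E(𝔽_p)`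
embeds. -/
theorem odd_addOrderOf_iff (r : ℕ) (φ : Frame r)
    (p : ℕ) [Fact p.Prime] (h2 : p ≠ 2) (h3 : p ≠ 3) (h17 : p ≠ 17)
    (𝔭 : Ideal (𝓞 (K r))) (h𝔭 : 𝔭.IsPrime) (hp𝔭 : (p : 𝓞 (K r)) ∈ 𝔭)
    (σ : Gal(K r/ℚ))
    (hσ : ∀ α : 𝓞 (K r), σ • α - α ^ p ∈ 𝔭)
    (hdet : (1 - φ.mat σ).det ≠ 0) (h : ℕ) :
    Odd (addOrderOf (2 ^ h • Pmod p h2 h3)) ↔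
      (2 ^ h : ZMod (2 ^ r)) • φ.vec σ ∈ rowImage (1 - φ.mat σ) := by
  classical
  have hp : p.Prime := Fact.out
  have := φ.finiteDimensional
  have : NumberField (K r) := ⟨⟩
  let v : IsDedekindDomain.HeightOneSpectrum (𝓞 (K r)) :=
    ⟨𝔭, h𝔭, fun h0 => by
      rw [h0, Ideal.mem_bot] at hp𝔭
      exact hp.ne_zero (by exact_mod_cast hp𝔭)⟩
  let k := IsLocalRing.ResidueField (place v)
  let ρ : place v →+* k := IsLocalRing.residue (place v)
  have hchar : CharP k p := by
    refine (CharP.charP_iff_prime_eq_zero hp).2 ?_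
    have := (residue_eq_zero_iff_mem v p).2 hp𝔭
    rw [← map_natCast ρ p, ← this]
    congr 1
  have hr : r ≠ 0 := by
    rintro rfl
    exact hdet (Subsingleton.elim (α := ZMod 1) _ _)
  have hne {n : ℕ} (hn : ¬ p ∣ n) : (n : k) ≠ 0 := fun h => hn ((CharP.cast_eq_zero_iff k p n).1 h)
  have hprime {q : ℕ} (hq : q.Prime) (hpq : p ≠ q) : ¬ p ∣ q :=
    fun h => hpq ((Nat.prime_dvd_prime_iff_eq hp hq).1 h)
  have h2k : (2 : k) ≠ 0 := by exact_mod_cast hne (hprime Nat.prime_two h2)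
  have h3k : (3 : k) ≠ 0 := by exact_mod_cast hne (hprime Nat.prime_three h3)
  have h17k : (17 : k) ≠ 0 := by exact_mod_cast hne (hprime (by norm_num) h17)
  have h6k : (6 : k) ≠ 0 := by
    rw [show (6 : k) = 2 * 3 by norm_num]
    exact mul_ne_zero h2k h3k
  have hΔ : (E.Δ : k) ≠ 0 := by
    rw [E_Δ, show ((612 : ℤ) : k) = 2 ^ 2 * 3 ^ 2 * 17 by norm_num]
    exact mul_ne_zero (mul_ne_zero (pow_ne_zero 2 h2k) (pow_ne_zero 2 h3k)) h17k
  have h6K : (6 : K r) ≠ 0 := by norm_num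
  let R : Pts (K r) →+ Pts k := redHom ρ hΔ
  let ι : Pts (ZMod p) →+ Pts k := mapPts (ZMod.castHom (dvd_refl p) k)
  obtain ⟨β, hβ⟩ := mem_range_of_preimage φ.hβ
  have hβP : 2 ^ r • β = P (K r) h6K :=
    toC_injective r (by rw [map_nsmul, hβ, φ.hβ, toC_P])
  have hRP : R (2 ^ r • β) = ι (Pmod p h2 h3) := by
    rw [hβP, Pmod, mapPts_P _ _ h6k]
    exact redHom_P ρ hΔ h6K h6k
  have hinj (g : Pts (K r)) (hg : 2 ^ r • g = 0) (hRg : R g = 0) : g = 0 :=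
    eq_zero_of_redHom_eq_zero ρ hΔ h2k r hg hRg
  have key := odd_addOrderOf_iff_of_equivariant R (galK r σ) (mapPts (frobenius k p))
    (red_map_eq_map_frobenius_red v hσ hΔ) r hinj
    (fun Q hQ => φ.exists_two_pow_nsmul_eq_zero_of_map R hinj
      (card_two_pow_torsion_le (card_two_torsion_le _ h2k) r) hQ)
    (fun g hg hσg => toC_injective r (by
      let T : Tors r := ⟨toC r g, mem_Tors.2 (by rw [← map_nsmul, hg, map_zero])⟩
      have := φ.two_pow_pred_nsmul_eq_zero σ hdet (T := T)
        (Subtype.ext (by rw [φ.coe_torsAct σ (g := g) rfl, hσg]))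
      rw [map_nsmul, map_zero]
      exact congr_arg Subtype.val this)) hr β (by rw [hβP, galK_P])
    (by rw [hRP]; exact ι.isOfFinAddOrder (isOfFinAddOrder_of_finite _)) h
  rw [hRP, ← map_nsmul, addOrderOf_injective ι (mapPts_injective _)] at key
  rw [key, φ.smul_vec_mem_rowImage_iff]
  constructor
  · rintro ⟨g, hg, hgβ⟩
    refine ⟨⟨toC r g, mem_Tors.2 (by rw [← map_nsmul, hg, map_zero])⟩, Subtype.ext ?_⟩
    rw [AddSubgroup.coe_nsmul, AddSubgroup.coe_sub, φ.coe_torsAct σ (g := g) rfl,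
      φ.coe_shift σ hβ, ← map_nsmul, hgβ, map_sub]
  · rintro ⟨T, hT⟩
    obtain ⟨g, hg, hgT⟩ := φ.exists_toC_eq T
    refine ⟨g, hg, toC_injective r ?_⟩
    have := congr_arg Subtype.val hT
    rw [AddSubgroup.coe_nsmul, AddSubgroup.coe_sub, φ.coe_torsAct σ hgT, φ.coe_shift σ hβ] at this
    rw [map_nsmul, this, map_sub, hgT]

end SomosFive

theorem mainTheorem7 (r : ℕ) (φ : SomosFive.Frame r)
    (p : ℕ) [Fact p.Prime] (h2 : p ≠ 2) (h3 : p ≠ 3) (h17 : p ≠ 17)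
    (𝔭 : Ideal (𝓞 (SomosFive.K r))) (h𝔭 : 𝔭.IsPrime) (hp𝔭 : (p : 𝓞 (SomosFive.K r)) ∈ 𝔭)
    (σ : Gal(SomosFive.K r/ℚ))
    (hσ : ∀ α : 𝓞 (SomosFive.K r), σ • α - α ^ p ∈ 𝔭)
    (v : Fin 2 → ZMod (2 ^ r)) (M : GL (Fin 2) (ZMod (2 ^ r)))
    (hρ : φ.rho σ = (v, M))
    (hdet : (1 - (M : Matrix (Fin 2) (Fin 2) (ZMod (2 ^ r)))).det ≠ 0) :
    (∀ h : ℕ, Odd (addOrderOf ((2 ^ h : ℕ) • SomosFive.Pmod p h2 h3)) ↔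
      (2 ^ h : ZMod (2 ^ r)) • v ∈
        SomosFive.rowImage (1 - (M : Matrix (Fin 2) (Fin 2) (ZMod (2 ^ r))))) ∧
    IsLeast {o : ℕ | (2 ^ o : ZMod (2 ^ r)) • v ∈
        SomosFive.rowImage (1 - (M : Matrix (Fin 2) (Fin 2) (ZMod (2 ^ r))))}
      (padicValNat 2 (addOrderOf (SomosFive.Pmod p h2 h3))) := by
  obtain ⟨rfl, rfl⟩ := Prod.ext_iff.1 hρ
  have hodd := SomosFive.odd_addOrderOf_iff r φ p h2 h3 h17 𝔭 h𝔭 hp𝔭 σ hσ hdet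
  have hle := SomosFive.odd_addOrderOf_two_pow_nsmul_iff
    (isOfFinAddOrder_of_finite (SomosFive.Pmod p h2 h3))
  exact ⟨hodd, (hodd _).1 ((hle _).2 le_rfl), fun o ho => (hle o).1 ((hodd o).2 ho)⟩
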